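/- Let $X_1, X_2, \dots$ be IID from a probability measure $P_0$ on a measurable space $\mathcal{X}$, let $\mathbb{P}_n$ be the empirical distribution of $X_1,\dots,X_n$, and write $Pf := \int f\,dP$, $\mathbb{P}_n f := n^{-1}\sum_{i=1}^n f(X_i)$ and $\mathbb{G}_n f := n^{1/2}(\mathbb{P}_n - P_0) f$. Let $T(\eta, P)$ be a real-valued functional of a nuisance parameter $\eta$ and a measure $P$, let $\eta_0$ be the true nuisance parameter and $\eta_n$ an estimator of it, let $\phi_0 : \mathcal{X} \to \mathbb{R}$ be a function with $P_0\phi_0 = 0$ and $P_0\phi_0^2 < \infty$ (the influence function), and let $\phi_n : \mathcal{X} \to \mathbb{R}$ be random functions (estimators of $\phi_0$). Random quantities need not be measurable: $P_0^*$ denotes outer probability, $Y_n = o_{P_0^*}(r_n)$ means $P_0^*(|Y_n| \geq \varepsilon r_n) \to 0$ for every $\varepsilon > 0$, and $\rightsquigarrow$ denotes weak convergence in the sense of outer expectations, that is, $G_n \rightsquigarrow G$ if $E^* h(G_n) \to E h(G)$ for all bounded continuous $h$. Put $R_n := T(\eta_n, \mathbb{P}_n) - T(\eta_0, P_0) - (\mathbb{P}_n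 - P_0)\phi_n$. Assume: (A1) there is a $P_0$-Donsker class $\mathcal{F}$ of measurable real-valued functions on $\mathcal{X}$ such that $\phi_0 \in \mathcal{F}$ and $\phi_n \in \mathcal{F}$ with probability tending to one, i.e. $P_0^*(\phi_n \notin \mathcal{F}) \to 0$; here $P_0$-Donsker means that $\mathcal{F} \subset L_2(P_0)$, that the paths $f \mapsto \mathbb{G}_n f$ are almost surely bounded on $\mathcal{F}$ for every $n$, and that $\mathbb{G}_n \rightsquigarrow \mathbb{G}_0$ in the space $\ell^\infty(\mathcal{F})$ of bounded functions on $\mathcal{F}$ with the supremum norm, where $\mathbb{G}_0$ is a tight, Borel measurable $P_0$-Brownian bridge process, i.e. a mean-zero Gaussian process with covariance function $P_0(fg) - P_0 f\, P_0 g$; (A2) $\|\phi_n - \phi_0\|_{L_2(P_0)} = o_{P_0^*}(1)$; (A3) $R_n = o_{P_0^*}(n^{-1/2})$. Then $T(\eta_n, \mathbb{P}_n) = T(\eta_0, P_0) + \mathbb{P}_n\phi_0 + o_{P_0^*}(n^{-1/2})$. Moreover $n^{1/2}\left[T(\eta_n, \mathbb{P}_n) - T(\eta_0, P_0)\right] \rightsquigarrow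 \mathbb{G}_0\phi_0$, and $\mathbb{G}_0\phi_0$ follows the normal distribution $N(0, P_0\phi_0^2)$. -/

import Mathlib

open MeasureTheory ProbabilityTheory Filter Topology
open scoped ENNReal NNReal BoundedContinuousFunction

noncomputable section

/-- The Banach space `ℓ^∞(F)` of bounded real-valued functions on the set of functions `F`, with
the supremum norm. -/
abbrev EllInfty {𝒳 : Type*} (F : Set (𝒳 → ℝ)) : Type _ := lp (fun _ : F => ℝ) ∞

/-- `ℓ^∞(F)` carries the Borel σ-algebra of its norm. -/
instance EllInfty.instMeasurableSpace {𝒳 : Type*} (F : Set (𝒳 → ℝ)) :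
    MeasurableSpace (EllInfty F) := borel _

instance EllInfty.instBorelSpace {𝒳 : Type*} (F : Set (𝒳 → ℝ)) : BorelSpace (EllInfty F) := ⟨rfl⟩

open Classical in
/-- A bounded function `z : F → ℝ` as an element of `ℓ^∞(F)` (the value `0` at an unbounded `z`
is a convention; it is only used on an event of probability zero). -/
def toEllInfty {𝒳 : Type*} (F : Set (𝒳 → ℝ)) (z : F → ℝ) : EllInfty F :=
  if hz : Memℓp z ∞ then ⟨z, hz⟩ else 0

/-- The outer expectation `E^* Z`: the infimum of `E U` over measurable `U` with `U ≥ Z` almost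
surely and `E U` finite. (It is applied to bounded `Z` and probability measures only, so the set
is nonempty and bounded below.) -/
def outerExpectation {Ω : Type*} [MeasurableSpace Ω] (μ : Measure Ω) (Z : Ω → ℝ) : ℝ :=
  sInf {e : ℝ | ∃ U : Ω → ℝ, Measurable U ∧ Integrable U μ ∧ (∀ᵐ ω ∂μ, Z ω ≤ U ω) ∧
    e = ∫ ω, U ω ∂μ}

/-- Weak convergence `G_n ⇝ G` of possibly non-measurable maps `G_n : Ω → D` to a limit with Borel
law `ν`: `E^* h(G_n) → E h(G)` for all bounded continuous `h : D → ℝ`. -/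
def WeaklyConverges {Ω D : Type*} [MeasurableSpace Ω] [TopologicalSpace D] [MeasurableSpace D]
    (μ : Measure Ω) (G : ℕ → Ω → D) (ν : Measure D) : Prop :=
  ∀ h : D →ᵇ ℝ, Tendsto (fun n => outerExpectation μ (fun ω => h (G n ω))) atTop
    (𝓝 (∫ z, h z ∂ν))

/-- `Y_n = o_{P^*}(n^{-1/2})`: for every `ε > 0` the outer probability of `√n |Y_n| ≥ ε` tends
to zero. (A measure, evaluated at an arbitrary set, is the outer measure of that set.) -/
def IsLittleOPRootN {Ω : Type*} [MeasurableSpace Ω] (μ : Measure Ω) (Y : ℕ → Ω → ℝ) : Prop :=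
  ∀ ε : ℝ, 0 < ε → Tendsto (fun n : ℕ => μ {ω | ε ≤ √(n : ℝ) * |Y n ω|}) atTop (𝓝 0)

/-- The empirical distribution `ℙ_n` of `X_1, …, X_n` (here `X 0, …, X (n - 1)`). -/
def empiricalMeasure {Ω 𝒳 : Type*} [MeasurableSpace 𝒳] (X : ℕ → Ω → 𝒳) (n : ℕ) (ω : Ω) :
    Measure 𝒳 :=
  (n : ℝ≥0∞)⁻¹ • ∑ i ∈ Finset.range n, Measure.dirac (X i ω)

/-- `ℙ_n f = n⁻¹ ∑ f(X_i)`. -/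
def empiricalMean {Ω 𝒳 : Type*} (X : ℕ → Ω → 𝒳) (n : ℕ) (ω : Ω) (f : 𝒳 → ℝ) : ℝ :=
  (n : ℝ)⁻¹ * ∑ i ∈ Finset.range n, f (X i ω)

/-- The empirical process `𝔾_n f = n^{1/2} (ℙ_n - P) f`. -/
def empiricalProcess {Ω 𝒳 : Type*} [MeasurableSpace 𝒳] (P : Measure 𝒳) (X : ℕ → Ω → 𝒳)
    (n : ℕ) (ω : Ω) (f : 𝒳 → ℝ) : ℝ :=
  √(n : ℝ) * (empiricalMean X n ω f - ∫ x, f x ∂P)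

/-- `ν` is the law on `ℓ^∞(F)` of a (tight, Borel measurable) `P`-Brownian bridge process:
a centred Gaussian process with covariance function `P(fg) - Pf Pg`. -/
structure IsBrownianBridgeLaw {𝒳 : Type*} [MeasurableSpace 𝒳] (P : Measure 𝒳)
    (F : Set (𝒳 → ℝ)) (ν : Measure (EllInfty F)) : Prop where
  isProbabilityMeasure : IsProbabilityMeasure ν
  tight : IsTightMeasureSet {ν}
  gaussian : IsGaussianProcess (fun (f : F) (z : EllInfty F) => z f) ν
  mean_zero : ∀ f : F, ∫ z, z f ∂ν = 0
  covariance_eq : ∀ f g : F, cov[fun z : EllInfty F => z f, fun z : EllInfty F => z g; ν] =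
    ∫ x, (f : 𝒳 → ℝ) x * (g : 𝒳 → ℝ) x ∂P - (∫ x, (f : 𝒳 → ℝ) x ∂P) * ∫ x, (g : 𝒳 → ℝ) x ∂P

/-- `F` is a `P`-Donsker class of measurable functions, with limit process of law `ν`:
`𝔾_n ⇝ 𝔾_0` in `ℓ^∞(F)`, where `𝔾_0` is the `P`-Brownian bridge. Square integrability of the
members of `F` is what gives the covariance function a meaning, and almost sure boundedness of
the sample paths is what makes `𝔾_n` a map into `ℓ^∞(F)`. -/
structure IsDonsker {Ω 𝒳 : Type*} [MeasurableSpace Ω] [MeasurableSpace 𝒳] (μ : Measure Ω)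
    (P : Measure 𝒳) (X : ℕ → Ω → 𝒳) (F : Set (𝒳 → ℝ)) (ν : Measure (EllInfty F)) : Prop where
  measurable : ∀ f ∈ F, Measurable f
  memLp_two : ∀ f ∈ F, MemLp f 2 P
  bounded : ∀ n : ℕ, ∀ᵐ ω ∂μ, Memℓp (fun f : F => empiricalProcess P X n ω f) ∞
  brownianBridge : IsBrownianBridgeLaw P F ν
  weaklyConverges : WeaklyConverges μ
    (fun n ω => toEllInfty F (fun f : F => empiricalProcess P X n ω f)) ν

end

/-! ### Outer expectation: comparison and Markov bounds -/

section OuterExpectation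

variable {Ω : Type*} [MeasurableSpace Ω] {μ : Measure Ω}

/-! Since `P₀ φ₀ = 0`, multiplying the error of the linear expansion by `√n` gives `√n R_n + (𝔾_n
φ_n - 𝔾_n φ₀)`. The first term is negligible by (A3), so everything rests on the second, whose index
`φ_n` is random and may depend on the sample.

The increment is controlled uniformly over an L²-ball around `φ₀`. Let `B` be the set of paths in
`ℓ^∞(F)` that differ by at least `ε` between `φ₀` and some `f` within `δ` of it. By tightness the
limit law nearly lives on a compact set of paths, where finitely many cells of indices suffice
(`IsCompact.exists_finite_oscillation_lt`). The supremum over the ball thus reduces to finitely many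
Chebyshev bounds, and even a thickening of `B` has small limit probability
(`exists_measure_oscillation_le`). The portmanteau bound `eventually_measure_lt` carries this over
to `𝔾_n`, giving `IsDonsker.tendsto_measure_abs_increment`.

For the limit law, evaluation at `φ₀` is continuous on `ℓ^∞(F)`, so `𝔾_n φ₀ ⇝ 𝔾₀ φ₀`. Slutsky's
lemma passes this to the estimator, and the Gaussian limit is identified by its mean and variance.
-/

theorem outerExpectation_le_integral [IsProbabilityMeasure μ] {Z U : Ω → ℝ} {c : ℝ}
    (hZ : ∀ ω, c ≤ Z ω) (hU : Measurable U) (hUi : Integrable U μ) (hZU : ∀ᵐ ω ∂μ, Z ω ≤ U ω) :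
    outerExpectation μ Z ≤ ∫ ω, U ω ∂μ := by
  refine csInf_le ⟨c, ?_⟩ ⟨U, hU, hUi, hZU, rfl⟩
  rintro e ⟨V, -, hVi, hZV, rfl⟩
  calc c = ∫ _, c ∂μ := by simp
    _ ≤ ∫ ω, V ω ∂μ := integral_mono_ae (integrable_const c) hVi
        (hZV.mono fun ω h => (hZ ω).trans h)

theorem outerExpectation_set_nonempty [IsFiniteMeasure μ] {Z : Ω → ℝ} {C : ℝ}
    (hZ : ∀ ω, Z ω ≤ C) :
    {e : ℝ | ∃ U : Ω → ℝ, Measurable U ∧ Integrable U μ ∧ (∀ᵐ ω ∂μ, Z ω ≤ U ω) ∧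
      e = ∫ ω, U ω ∂μ}.Nonempty :=
  ⟨_, fun _ => C, measurable_const, integrable_const C, ae_of_all μ hZ, rfl⟩

/-- Outer expectations of two bounded maps that are `ε`-close off a set `A` are close. -/
theorem outerExpectation_le_add [IsProbabilityMeasure μ] {Z W : Ω → ℝ} {C ε : ℝ} {A : Set Ω}
    (hε : 0 ≤ ε) (hZ : ∀ ω, |Z ω| ≤ C) (hW : ∀ ω, |W ω| ≤ C)
    (h : ∀ ω, ω ∉ A → Z ω ≤ W ω + ε) :
    outerExpectation μ Z ≤ outerExpectation μ W + (ε + 2 * C * μ.real A) := by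
  rw [← sub_le_iff_le_add]
  refine le_csInf (outerExpectation_set_nonempty fun ω => (abs_le.1 (hW ω)).2) ?_
  rintro e ⟨U, hU, hUi, hWU, rfl⟩
  rw [sub_le_iff_le_add]
  -- `A` need not be measurable; its measurable hull has the same measure. The penalty `2 * C` on
  -- the hull covers the largest possible gap between `Z` and `W`.
  have hA := measurableSet_toMeasurable μ A
  have hind : Integrable ((toMeasurable μ A).indicator fun _ => 2 * C) μ :=
    (integrable_const _).indicator hA
  have key := outerExpectation_le_integral (μ := μ) (Z := Z) (c := -C)
    (U := fun ω => U ω + (ε + (toMeasurable μ A).indicator (fun _ => 2 * C) ω))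
    (fun ω => (abs_le.1 (hZ ω)).1)
    (hU.add (measurable_const.add (measurable_const.indicator hA)))
    (hUi.add ((integrable_const _).add hind)) ?_
  · refine key.trans (le_of_eq ?_)
    have h1 : ∫ ω, (ε + (toMeasurable μ A).indicator (fun _ => 2 * C) ω) ∂μ =
        ε + 2 * C * μ.real A := by
      rw [integral_add (integrable_const _) hind, integral_indicator_const _ hA]
      simp [measureReal_def, mul_comm]
    rw [← h1]
    exact integral_add hUi ((integrable_const _).add hind)
  · filter_upwards [hWU] with ω hω
    have h1 := abs_le.1 (hZ ω)
    have h2 := abs_le.1 (hW ω)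
    by_cases hωA : ω ∈ A
    · rw [Set.indicator_of_mem (subset_toMeasurable μ A hωA)]
      linarith
    · have h3 := h ω hωA
      have h4 : 0 ≤ (toMeasurable μ A).indicator (fun _ => 2 * C) ω :=
        Set.indicator_nonneg (fun _ _ => by linarith) ω
      linarith

/-- Markov's inequality for outer probability and outer expectation. -/
theorem measure_one_le_le_outerExpectation [IsProbabilityMeasure μ] {Z : Ω → ℝ}
    (h0 : ∀ ω, 0 ≤ Z ω) (h1 : ∀ ω, Z ω ≤ 1) :
    μ.real {ω | 1 ≤ Z ω} ≤ outerExpectation μ Z := by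
  refine le_csInf (outerExpectation_set_nonempty h1) ?_
  rintro e ⟨U, hU, hUi, hZU, rfl⟩
  have hU0 : 0 ≤ᵐ[μ] U := hZU.mono fun ω h => (h0 ω).trans h
  calc μ.real {ω | 1 ≤ Z ω} ≤ μ.real {ω | 1 ≤ U ω} :=
        ENNReal.toReal_mono (measure_ne_top _ _)
          (measure_mono_ae (hZU.mono fun ω h h' => le_trans h' h))
    _ = 1 * μ.real {ω | 1 ≤ U ω} := (one_mul _).symm
    _ ≤ ∫ ω, U ω ∂μ := mul_meas_ge_le_integral_of_nonneg hU0 hUi 1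

end OuterExpectation

/-! ### Weak convergence without measurability: mapping, portmanteau, Slutsky -/

section WeakConvergence

theorem WeaklyConverges.map {Ω : Type*} [MeasurableSpace Ω] {μ : Measure Ω}
    {D E : Type*} [TopologicalSpace D] [MeasurableSpace D] [BorelSpace D]
    [TopologicalSpace E] [TopologicalSpace.PseudoMetrizableSpace E] [MeasurableSpace E]
    [BorelSpace E] {G : ℕ → Ω → D} {ν : Measure D} [IsFiniteMeasure ν]
    (hG : WeaklyConverges μ G ν) {g : D → E} (hg : Continuous g) :
    WeaklyConverges μ (fun n ω => g (G n ω)) (ν.map g) := by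
  intro h
  rw [integral_map hg.measurable.aemeasurable
    h.continuous.measurable.aestronglyMeasurable]
  exact hG (h.compContinuous ⟨g, hg⟩)

variable {Ω : Type*} [MeasurableSpace Ω] {μ : Measure Ω} [IsProbabilityMeasure μ]

/-- Upper portmanteau bound for weak convergence in the sense of outer expectations. -/
theorem WeaklyConverges.eventually_measure_lt {D : Type*} [PseudoMetricSpace D]
    [MeasurableSpace D] [OpensMeasurableSpace D] {G : ℕ → Ω → D} {ν : Measure D}
    [IsProbabilityMeasure ν] (hG : WeaklyConverges μ G ν) {r : ℝ} (hr : 0 < r) {B : Set D}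
    {c : ℝ≥0∞} (hc : ν (Metric.thickening r B) < c) : ∀ᶠ n in atTop, μ {ω | G n ω ∈ B} < c := by
  have hk : ∀ z, ((thickenedIndicator hr B z : ℝ≥0) : ℝ) ≤ 1 := fun z => by
    exact_mod_cast thickenedIndicator_le_one hr B z
  -- A continuous function equal to `1` on `B` and `0` off its thickening: Markov bounds the outer
  -- probability of `B` by its outer expectation, while its limit integral is at most the mass of
  -- the thickening.
  let h : D →ᵇ ℝ := BoundedContinuousFunction.ofNormedAddCommGroup
    (fun z => ((thickenedIndicator hr B z : ℝ≥0) : ℝ))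
    (NNReal.continuous_coe.comp (thickenedIndicator hr B).continuous) 1
    (fun z => (Real.norm_of_nonneg (NNReal.coe_nonneg _)).trans_le (hk z))
  have hint : ∫ z, h z ∂ν ≤ ν.real (Metric.thickening r B) := by
    rw [← integral_indicator_one Metric.isOpen_thickening.measurableSet]
    refine integral_mono (h.integrable ν)
      ((integrable_const 1).indicator Metric.isOpen_thickening.measurableSet) fun z => ?_
    by_cases hz : z ∈ Metric.thickening r B
    · rw [Set.indicator_of_mem hz]
      exact hk z
    · rw [Set.indicator_of_notMem hz]
      exact (congrArg NNReal.toReal (thickenedIndicator_zero hr B hz)).le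
  have hle : ∀ n, μ {ω | G n ω ∈ B} ≤ ENNReal.ofReal (outerExpectation μ fun ω => h (G n ω)) := by
    intro n
    have hmarkov : μ.real {ω | 1 ≤ h (G n ω)} ≤ outerExpectation μ fun ω => h (G n ω) :=
      measure_one_le_le_outerExpectation (fun ω => NNReal.coe_nonneg _) (fun ω => hk _)
    refine (measure_mono fun ω hω => ?_).trans
      ((ENNReal.le_ofReal_iff_toReal_le (measure_ne_top _ _)
        (measureReal_nonneg.trans hmarkov)).2 hmarkov)
    exact (congrArg NNReal.toReal (thickenedIndicator_one hr B hω)).ge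
  have hlt : ENNReal.ofReal (∫ z, h z ∂ν) < c :=
    ((ENNReal.ofReal_le_ofReal hint).trans_eq (ofReal_measureReal (measure_ne_top _ _))).trans_lt hc
  filter_upwards [(ENNReal.tendsto_ofReal (hG h)).eventually (gt_mem_nhds hlt)] with n hn
  exact (hle n).trans_lt hn

/-- Slutsky's lemma for real-valued, possibly non-measurable maps. -/
theorem WeaklyConverges.of_tendsto_measure_dist {G Y : ℕ → Ω → ℝ} {ν : Measure ℝ}
    [IsProbabilityMeasure ν] (hG : WeaklyConverges μ G ν)
    (hY : ∀ δ : ℝ, 0 < δ → Tendsto (fun n => μ {ω | δ ≤ |Y n ω - G n ω|}) atTop (𝓝 0)) :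
    WeaklyConverges μ Y ν := by
  intro h
  rw [Metric.tendsto_atTop']
  intro ε hε
  set C := ‖h‖ with hC
  have hC0 : 0 ≤ C := norm_nonneg h
  have hb : ∀ x, |h x| ≤ C := fun x => h.norm_coe_le_norm x
  -- `a` bounds each of the two exceptional probabilities below; the `+ 1` keeps the denominator
  -- positive when `h = 0`.
  obtain ⟨a, ha0, ha⟩ : ∃ a : ℝ, 0 < a ∧ 2 * C * (a + a) ≤ ε / 3 :=
    ⟨ε / (12 * (C + 1)), by positivity, by
      rw [← sub_nonneg]
      have : ε / 3 - 2 * C * (ε / (12 * (C + 1)) + ε / (12 * (C + 1))) = ε / (3 * (C + 1)) := by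
        field_simp; ring
      rw [this]; positivity⟩
  have ha' : (0 : ℝ≥0∞) < ENNReal.ofReal a := ENNReal.ofReal_pos.2 ha0
  have htight : IsTightMeasureSet {ν} := isTightMeasureSet_singleton
  obtain ⟨M, hM⟩ := ((tendsto_measure_norm_gt_of_isTightMeasureSet htight).eventually
    (gt_mem_nhds ha')).exists
  -- Raising the level to `M + 1` leaves room for a thickening of radius `1`.
  have hM' : ν (Metric.thickening 1 {x : ℝ | M + 1 ≤ |x|}) < ENNReal.ofReal a := by
    refine lt_of_le_of_lt (b := ν {x | M < ‖x‖}) (measure_mono ?_) (by simpa using hM)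
    · intro x hx
      obtain ⟨y, hy, hxy⟩ := Metric.mem_thickening_iff.1 hx
      have h1 := abs_sub_abs_le_abs_sub y x
      rw [Real.dist_eq, abs_sub_comm] at hxy
      simp only [Set.mem_ofPred_eq, Real.norm_eq_abs] at hy ⊢
      linarith
  -- If `|G n ω| < M + 1` and `|Y n ω - G n ω| < 1`, both points lie in the ball of radius `M + 2`,
  -- where `h` is uniformly continuous.
  obtain ⟨δ, hδ0, hδ⟩ := Metric.uniformContinuousOn_iff.1
    ((isCompact_closedBall (0 : ℝ) (M + 2)).uniformContinuousOn_of_continuous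
      h.continuous.continuousOn) (ε / 3) (by positivity)
  have hη : 0 < min δ 1 := lt_min hδ0 one_pos
  have e1 := hG.eventually_measure_lt one_pos hM'
  have e2 := (hY _ hη).eventually (gt_mem_nhds ha')
  have e3 := (Metric.tendsto_nhds.1 (hG h)) (ε / 3) (by positivity)
  have key : ∀ᶠ n in atTop, dist (outerExpectation μ fun ω => h (Y n ω)) (∫ z, h z ∂ν) < ε := by
    filter_upwards [e1, e2, e3] with n h1 h2 h3
    set A := {ω | G n ω ∈ {x : ℝ | M + 1 ≤ |x|}} ∪ {ω | min δ 1 ≤ |Y n ω - G n ω|} with hA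
    have hAm : μ.real A ≤ a + a := by
      refine (measureReal_union_le _ _).trans (add_le_add ?_ ?_)
      · exact (ENNReal.toReal_le_of_le_ofReal ha0.le h1.le)
      · exact (ENNReal.toReal_le_of_le_ofReal ha0.le h2.le)
    have hclose : ∀ ω, ω ∉ A → |h (Y n ω) - h (G n ω)| < ε / 3 := by
      intro ω hω
      simp only [hA, Set.mem_union, Set.mem_ofPred_eq, not_or, not_le, lt_min_iff] at hω
      obtain ⟨hω1, hω2, hω3⟩ := hω
      have h4 := abs_sub_abs_le_abs_sub (Y n ω) (G n ω)
      refine hδ (Y n ω) ?_ (G n ω) ?_ hω2 <;> rw [mem_closedBall_zero_iff, Real.norm_eq_abs] <;>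
        linarith
    have hCA : 2 * C * μ.real A ≤ ε / 3 :=
      (mul_le_mul_of_nonneg_left hAm (by positivity)).trans ha
    have u1 := outerExpectation_le_add (μ := μ) (Z := fun ω => h (Y n ω))
      (W := fun ω => h (G n ω)) (A := A) (ε := ε / 3) (by positivity) (fun ω => hb _)
      (fun ω => hb _) (fun ω hω => by linarith [(abs_lt.1 (hclose ω hω)).2])
    have u2 := outerExpectation_le_add (μ := μ) (Z := fun ω => h (G n ω))
      (W := fun ω => h (Y n ω)) (A := A) (ε := ε / 3) (by positivity) (fun ω => hb _)
      (fun ω => hb _) (fun ω hω => by linarith [(abs_lt.1 (hclose ω hω)).1])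
    rw [Real.dist_eq, abs_lt] at h3 ⊢
    constructor <;> linarith
  exact (eventually_atTop.1 key).imp fun N hN n hn => hN n hn.le

end WeakConvergence

/-! ### Paths in `ℓ^∞(F)` and compact sets of paths -/

section EllInfty

variable {𝒳 : Type*} {F : Set (𝒳 → ℝ)}

theorem EllInfty.abs_apply_sub_le (z w : EllInfty F) (f : F) : |z f - w f| ≤ ‖z - w‖ := by
  simpa using lp.norm_apply_le_norm ENNReal.top_ne_zero (z - w) f

theorem EllInfty.continuous_apply (f : F) : Continuous fun z : EllInfty F => z f :=
  (lp.evalCLM ℝ (fun _ : F => ℝ) ∞ f).continuous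

theorem toEllInfty_apply {z : F → ℝ} (hz : Memℓp z ∞) (f : F) : toEllInfty F z f = z f := by
  rw [toEllInfty, dif_pos hz]

end EllInfty

/-- On a compact subset of `ℓ^∞(F)`, the index set splits into finitely many cells on which all
paths vary by less than `ε`. -/
theorem IsCompact.exists_finite_oscillation_lt {𝒳 : Type*} {F : Set (𝒳 → ℝ)}
    {K : Set (EllInfty F)} (hK : IsCompact K) {ε : ℝ} (hε : 0 < ε) :
    ∃ (N : ℕ) (c : F → Fin N), ∀ f g, c f = c g → ∀ z ∈ K, |z f - z g| < ε := by
  obtain ⟨t, -, ht, hKt⟩ := hK.finite_cover_balls (e := ε / 4) (by positivity)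
  have := ht.fintype
  -- Each index is recorded by the values there of the finitely many net paths. These vectors are
  -- bounded in a finite-dimensional space, so finitely many `ε / 8`-balls cover them and define the
  -- cells. Passing from `z` to a net path and back costs `ε / 4` at each of `f` and `g`, and the
  -- net path itself varies by less than `ε / 4`.
  let Φ : F → (t → ℝ) := fun f z => (z : EllInfty F) f
  have hbdd : TotallyBounded (Set.range Φ) := by
    refine (isCompact_closedBall (0 : t → ℝ) (∑ z : t, ‖(z : EllInfty F)‖)).totallyBounded.subset ?_
    rintro _ ⟨f, rfl⟩
    rw [mem_closedBall_zero_iff, pi_norm_le_iff_of_nonneg (by positivity)]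
    intro z
    exact (lp.norm_apply_le_norm ENNReal.top_ne_zero (z : EllInfty F) f).trans
      (Finset.single_le_sum (f := fun z : t => ‖(z : EllInfty F)‖)
        (fun _ _ => norm_nonneg _) (Finset.mem_univ z))
  obtain ⟨s, hs, hcov⟩ := Metric.totallyBounded_iff.1 hbdd (ε / 8) (by positivity)
  have hex : ∀ f, ∃ y : s, dist (Φ f) y.1 < ε / 8 := by
    intro f
    obtain ⟨y, hy, hfy⟩ := Set.mem_iUnion₂.1 (hcov ⟨f, rfl⟩)
    exact ⟨⟨y, hy⟩, hfy⟩
  choose c hc using hex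
  have := hs.to_subtype
  refine ⟨Nat.card s, fun f => Finite.equivFin s (c f), fun f g hfg z hz => ?_⟩
  have hcfg : c f = c g := (Finite.equivFin s).injective hfg
  obtain ⟨w, hw, hzw⟩ := Set.mem_iUnion₂.1 (hKt hz)
  rw [mem_ball_iff_norm] at hzw
  have h1 := abs_le.1 (EllInfty.abs_apply_sub_le z w f)
  have h2 := abs_le.1 (EllInfty.abs_apply_sub_le z w g)
  have h3 : dist (Φ f) (Φ g) < ε / 4 := by
    have := dist_triangle_right (Φ f) (Φ g) (c f).1
    have h4 := hc f
    have h5 := hc g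
    rw [← hcfg] at h5
    linarith
  have h4 := (dist_le_pi_dist (Φ f) (Φ g) ⟨w, hw⟩).trans_lt h3
  rw [Real.dist_eq, abs_lt] at h4
  simp only [Φ] at h4
  rw [abs_lt]
  constructor <;> linarith

/-! ### Increments of the Brownian bridge -/

namespace IsBrownianBridgeLaw

variable {𝒳 : Type*} [MeasurableSpace 𝒳] {P : Measure 𝒳} {F : Set (𝒳 → ℝ)}
  {ν : Measure (EllInfty F)}

theorem memLp_two_apply (hν : IsBrownianBridgeLaw P F ν) (f : F) :
    MemLp (fun z : EllInfty F => z f) 2 ν :=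
  (hν.gaussian.hasGaussianLaw_eval f).memLp_two

theorem variance_apply (hν : IsBrownianBridgeLaw P F ν) (f : F) :
    Var[fun z : EllInfty F => z f; ν] =
      ∫ x, f.1 x ^ 2 ∂P - (∫ x, f.1 x ∂P) ^ 2 := by
  rw [← covariance_self (hν.memLp_two_apply f).aemeasurable, hν.covariance_eq]
  simp only [pow_two]

/-- Expanding the covariances gives `P(f - g)² - (Pf - Pg)²`; only the subtracted square is dropped.
-/
theorem variance_sub_le (hν : IsBrownianBridgeLaw P F ν) {f g : F} (hf : MemLp f.1 2 P)
    (hg : MemLp g.1 2 P) :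
    Var[fun z : EllInfty F => z f - z g; ν] ≤
      ∫ x, (f.1 x - g.1 x) ^ 2 ∂P := by
  have := hν.isProbabilityMeasure
  rw [variance_fun_sub (hν.memLp_two_apply f) (hν.memLp_two_apply g), hν.variance_apply,
    hν.variance_apply, hν.covariance_eq]
  have hfg : Integrable (fun x => f.1 x * g.1 x) P := hf.integrable_mul hg
  have e : ∫ x, (f.1 x - g.1 x) ^ 2 ∂P = ∫ x, f.1 x ^ 2 ∂P -
      2 * ∫ x, f.1 x * g.1 x ∂P + ∫ x, g.1 x ^ 2 ∂P := by
    have hsub : Integrable (fun x => f.1 x ^ 2 - 2 * (f.1 x * g.1 x)) P :=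
      hf.integrable_sq.sub (hfg.const_mul 2)
    rw [← integral_const_mul, ← integral_sub hf.integrable_sq (hfg.const_mul 2),
      ← integral_add hsub hg.integrable_sq]
    exact integral_congr_ae (ae_of_all _ fun x => by ring)
  rw [e]
  nlinarith [sq_nonneg (∫ x, f.1 x ∂P - ∫ x, g.1 x ∂P)]

/-- Chebyshev's inequality for the increments of a Brownian bridge. -/
theorem measure_le_abs_sub_le (hν : IsBrownianBridgeLaw P F ν) {f g : F} (hf : MemLp f.1 2 P)
    (hg : MemLp g.1 2 P) {δ ε : ℝ} (hδ : 0 < δ) (hε : 0 < ε)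
    (hfg : eLpNorm (f.1 - g.1) 2 P < ENNReal.ofReal δ) :
    ν {z | ε ≤ |z f - z g|} ≤ ENNReal.ofReal (δ ^ 2 / ε ^ 2) := by
  have := hν.isProbabilityMeasure
  have hL := (hν.memLp_two_apply f).sub (hν.memLp_two_apply g)
  have hmean : ∫ z : EllInfty F, (z f - z g) ∂ν = 0 := by
    rw [integral_sub ((hν.memLp_two_apply f).integrable one_le_two)
      ((hν.memLp_two_apply g).integrable one_le_two), hν.mean_zero, hν.mean_zero, sub_zero]
  have hcheb := meas_ge_le_variance_div_sq hL hε
  simp only [Pi.sub_apply, hmean, sub_zero] at hcheb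
  refine hcheb.trans (ENNReal.ofReal_le_ofReal ?_)
  gcongr
  refine (hν.variance_sub_le hf hg).trans ?_
  have h1 := (hf.sub hg).eLpNorm_eq_integral_rpow_norm two_ne_zero ENNReal.ofNat_ne_top
  rw [h1, ENNReal.ofReal_lt_ofReal_iff hδ] at hfg
  have hnn : 0 ≤ ∫ x, (f.1 x - g.1 x) ^ 2 ∂P :=
    integral_nonneg fun x => sq_nonneg _
  simp only [ENNReal.toReal_ofNat, Pi.sub_apply, Real.norm_eq_abs, Real.rpow_two, sq_abs] at hfg
  rw [show ((2 : ℝ)⁻¹) = 1 / 2 by norm_num, ← Real.sqrt_eq_rpow] at hfg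
  exact (Real.sqrt_le_left hδ.le).1 hfg.le

/-- The paths of a tight Brownian bridge are equicontinuous in probability with respect to the
`L²(P)` distance. -/
theorem exists_measure_oscillation_le (hν : IsBrownianBridgeLaw P F ν)
    (hF : ∀ f ∈ F, MemLp f 2 P) (g : F) {ε c : ℝ} (hε : 0 < ε) (hc : 0 < c) :
    ∃ δ : ℝ, 0 < δ ∧ ν {z | ∃ f : F, eLpNorm (f.1 - g.1) 2 P < ENNReal.ofReal δ ∧
      ε ≤ |z f - z g|} ≤ ENNReal.ofReal c := by
  obtain ⟨K, hK, hKc⟩ := isTightMeasureSet_iff_exists_isCompact_measure_compl_le.1 hν.tight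
    (ENNReal.ofReal (c / 2)) (ENNReal.ofReal_pos.2 (by positivity))
  replace hKc := hKc ν rfl
  obtain ⟨N, cell, hcell⟩ := hK.exists_finite_oscillation_lt (ε := ε / 2) (by positivity)
  -- `δ²` is chosen so that `N` Chebyshev bounds `δ² / (ε / 2)²` add up to at most `c / 2`; the
  -- other `c / 2` pays for the complement of `K`.
  have hδpos : 0 < c / 2 * (ε / 2) ^ 2 / (N + 1) := by positivity
  set δ := √(c / 2 * (ε / 2) ^ 2 / (N + 1)) with hδ
  have hδ0 : 0 < δ := Real.sqrt_pos.2 hδpos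
  -- One representative per cell, taken inside the `δ`-ball around `g`, replaces a possibly
  -- uncountable union by a finite one. A cell that misses the ball gets the harmless value `g`.
  have hrep : ∀ i : Fin N, ∃ f : F, eLpNorm (f.1 - g.1) 2 P < ENNReal.ofReal δ ∧
      ∀ f' : F, eLpNorm (f'.1 - g.1) 2 P < ENNReal.ofReal δ → cell f' = i →
        cell f = i := by
    intro i
    by_cases h : ∃ f : F, eLpNorm (f.1 - g.1) 2 P < ENNReal.ofReal δ ∧ cell f = i
    · obtain ⟨f, hf, hfi⟩ := h
      exact ⟨f, hf, fun _ _ _ => hfi⟩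
    · refine ⟨g, by simpa using hδ0, fun f' hf' hi => (h ⟨f', hf', hi⟩).elim⟩
  choose rep hrep_lt hrep_cell using hrep
  refine ⟨δ, hδ0, ?_⟩
  have hsub : {z : EllInfty F | ∃ f : F, eLpNorm (f.1 - g.1) 2 P < ENNReal.ofReal δ ∧
      ε ≤ |z f - z g|} ⊆ Kᶜ ∪ ⋃ i : Fin N, {z | ε / 2 ≤ |z (rep i) - z g|} := by
    rintro z ⟨f, hf, hzf⟩
    by_cases hz : z ∈ K
    · refine Or.inr (Set.mem_iUnion.2 ⟨cell f, ?_⟩)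
      have h1 := hcell f (rep (cell f)) (hrep_cell _ f hf rfl).symm z hz
      have h2 := abs_sub_le (z f) (z (rep (cell f))) (z g)
      simp only [Set.mem_ofPred_eq]
      linarith
    · exact Or.inl hz
  calc _ ≤ ν (Kᶜ ∪ ⋃ i : Fin N, {z | ε / 2 ≤ |z (rep i) - z g|}) := measure_mono hsub
    _ ≤ ν Kᶜ + ∑ i : Fin N, ν {z | ε / 2 ≤ |z (rep i) - z g|} :=
        (measure_union_le _ _).trans (by gcongr; exact measure_iUnion_fintype_le _ _)
    _ ≤ ENNReal.ofReal (c / 2) + ∑ i : Fin N, ENNReal.ofReal (δ ^ 2 / (ε / 2) ^ 2) := by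
        gcongr with i
        exact hν.measure_le_abs_sub_le (hF _ (rep i).2) (hF _ g.2) hδ0 (by positivity) (hrep_lt i)
    _ = ENNReal.ofReal (c / 2) + ENNReal.ofReal (N * (δ ^ 2 / (ε / 2) ^ 2)) := by
        rw [Finset.sum_const, Finset.card_univ, Fintype.card_fin, nsmul_eq_mul,
          ENNReal.ofReal_mul (Nat.cast_nonneg N), ENNReal.ofReal_natCast]
    _ ≤ ENNReal.ofReal (c / 2) + ENNReal.ofReal (c / 2) := by
        gcongr
        rw [hδ, Real.sq_sqrt hδpos.le]
        have : (N : ℝ) * (c / 2 * (ε / 2) ^ 2 / (N + 1) / (ε / 2) ^ 2) =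
            N / (N + 1) * (c / 2) := by field_simp
        rw [this]
        refine mul_le_of_le_one_left (by positivity) ?_
        rw [div_le_one (by positivity)]
        linarith
    _ = ENNReal.ofReal c := by
        rw [← ENNReal.ofReal_add (by positivity) (by positivity), add_halves]

end IsBrownianBridgeLaw

/-! ### Asymptotic equicontinuity and the main theorem -/

/-- Asymptotic equicontinuity: the empirical process over a Donsker class does not distinguish a
random index consistent in `L²(P)` from its limit. -/
theorem IsDonsker.tendsto_measure_abs_increment {Ω 𝒳 : Type*} [MeasurableSpace Ω]
    [MeasurableSpace 𝒳] {μ : Measure Ω} [IsProbabilityMeasure μ] {P : Measure 𝒳}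
    {X : ℕ → Ω → 𝒳} {F : Set (𝒳 → ℝ)} {ν : Measure (EllInfty F)} (hF : IsDonsker μ P X F ν)
    {g : 𝒳 → ℝ} (hg : g ∈ F) {φ : ℕ → Ω → 𝒳 → ℝ}
    (hφ_mem : Tendsto (fun n => μ {ω | φ n ω ∉ F}) atTop (𝓝 0))
    (hφ : ∀ ε : ℝ≥0∞, 0 < ε →
      Tendsto (fun n => μ {ω | ε ≤ eLpNorm (φ n ω - g) 2 P}) atTop (𝓝 0))
    {ε : ℝ} (hε : 0 < ε) :
    Tendsto (fun n => μ {ω | ε ≤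
      |(empiricalProcess P X n ω (φ n ω) - empiricalProcess P X n ω g)|})
      atTop (𝓝 0) := by
  have := hF.brownianBridge.isProbabilityMeasure
  rw [ENNReal.tendsto_nhds_zero]
  intro c hc
  have hc3 : 0 < c / 3 := ENNReal.div_pos hc.ne' ENNReal.ofNat_ne_top
  obtain ⟨a, -, ha0, hac⟩ := ENNReal.lt_iff_exists_real_btwn.1 hc3
  obtain ⟨δ, hδ, hνδ⟩ := hF.brownianBridge.exists_measure_oscillation_le hF.memLp_two ⟨g, hg⟩
    (half_pos hε) (ENNReal.ofReal_pos.1 ha0)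
  set B : Set (EllInfty F) := {z | ∃ f : F,
    eLpNorm (f.1 - g) 2 P < ENNReal.ofReal δ ∧ ε ≤ |z f - z ⟨g, hg⟩|} with hB
  -- Moving a path by less than `ε / 4` in supremum norm changes an increment by less than `ε / 2`,
  -- so every path in the thickening still has an increment of at least `ε / 2`.
  have hthick : ν (Metric.thickening (ε / 4) B) < c / 3 := by
    refine ((measure_mono ?_).trans hνδ).trans_lt hac
    intro z hz
    obtain ⟨w, ⟨f, hf, hwf⟩, hzw⟩ := Metric.mem_thickening_iff.1 hz
    refine ⟨f, hf, ?_⟩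
    rw [dist_eq_norm] at hzw
    have h1 := abs_le.1 (EllInfty.abs_apply_sub_le z w f)
    have h2 := abs_le.1 (EllInfty.abs_apply_sub_le z w ⟨g, hg⟩)
    rcases le_abs.1 hwf with h | h
    · exact le_abs.2 (Or.inl (by linarith))
    · exact le_abs.2 (Or.inr (by linarith))
  have e1 := hF.weaklyConverges.eventually_measure_lt (by positivity) hthick
  have e2 := hφ_mem.eventually (gt_mem_nhds hc3)
  have e3 := (hφ _ (ENNReal.ofReal_pos.2 hδ)).eventually (gt_mem_nhds hc3)
  filter_upwards [e1, e2, e3] with n h1 h2 h3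
  set Gn : Ω → EllInfty F := fun ω => toEllInfty F fun f : F => empiricalProcess P X n ω f
  calc _ ≤ μ ({ω | Gn ω ∈ B} ∪ {ω | φ n ω ∉ F} ∪
        {ω | ENNReal.ofReal δ ≤ eLpNorm (φ n ω - g) 2 P}) := by
        -- The inclusion holds only almost surely: on unbounded paths `toEllInfty` takes its default
        -- value `0`.
        refine measure_mono_ae ?_
        filter_upwards [hF.bounded n] with ω hω hεω
        by_contra hcon
        change ω ∉ ({ω | Gn ω ∈ B} ∪ {ω | φ n ω ∉ F} ∪
          {ω | ENNReal.ofReal δ ≤ eLpNorm (φ n ω - g) 2 P} : Set Ω) at hcon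
        simp only [Set.mem_union, Set.mem_ofPred_eq, not_or, not_not, not_le] at hcon
        obtain ⟨⟨hGB, hmem⟩, hlt⟩ := hcon
        refine hGB ⟨⟨φ n ω, hmem⟩, hlt, ?_⟩
        simp only [Gn, toEllInfty_apply hω]
        exact hεω
    _ ≤ c / 3 + c / 3 + c / 3 :=
        (measure_union_le _ _).trans (add_le_add ((measure_union_le _ _).trans
          (add_le_add h1.le h2.le)) h3.le)
    _ = c := ENNReal.add_thirds c

theorem tendsto_measure_le_abs_add {Ω : Type*} [MeasurableSpace Ω] {μ : Measure Ω}
    {Y Z : ℕ → Ω → ℝ} (hY : ∀ ε : ℝ, 0 < ε → Tendsto (fun n => μ {ω | ε ≤ |Y n ω|}) atTop (𝓝 0))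
    (hZ : ∀ ε : ℝ, 0 < ε → Tendsto (fun n => μ {ω | ε ≤ |Z n ω|}) atTop (𝓝 0))
    {ε : ℝ} (hε : 0 < ε) :
    Tendsto (fun n => μ {ω | ε ≤ |Y n ω + Z n ω|}) atTop (𝓝 0) := by
  have h := (hY _ (half_pos hε)).add (hZ _ (half_pos hε))
  rw [add_zero] at h
  refine tendsto_of_tendsto_of_tendsto_of_le_of_le tendsto_const_nhds h (fun _ => zero_le)
    fun n => (measure_mono fun ω hω => ?_).trans (measure_union_le _ _)
  by_contra hcon
  simp only [Set.mem_union, Set.mem_ofPred_eq, not_or, not_le] at hcon hω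
  linarith [abs_add_le (Y n ω) (Z n ω)]

theorem theorem1 {Ω 𝒳 H : Type*} [MeasurableSpace Ω] [MeasurableSpace 𝒳]
    -- an IID sample `X 0, X 1, …` from `P₀`
    (μ : Measure Ω) [IsProbabilityMeasure μ]
    (P₀ : Measure 𝒳) [IsProbabilityMeasure P₀]
    (X : ℕ → Ω → 𝒳) (hX_meas : ∀ i, Measurable (X i)) (hX_indep : iIndepFun X μ)
    (hX_law : ∀ i, μ.map (X i) = P₀)
    -- the functional, the nuisance parameter and its estimator
    (T : H → Measure 𝒳 → ℝ) (η₀ : H) (η : ℕ → Ω → H)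
    -- the influence function and its estimator
    (φ₀ : 𝒳 → ℝ) (hφ₀_mean : ∫ x, φ₀ x ∂P₀ = 0) (hφ₀_sq : MemLp φ₀ 2 P₀)
    (φ : ℕ → Ω → 𝒳 → ℝ)
    -- (A1)
    (F : Set (𝒳 → ℝ)) (hφ₀_mem : φ₀ ∈ F)
    (hφ_mem : Tendsto (fun n => μ {ω | φ n ω ∉ F}) atTop (𝓝 0))
    (ν : Measure (EllInfty F)) (hF : IsDonsker μ P₀ X F ν)
    -- (A2)
    (hφ_cons : ∀ ε : ℝ≥0∞, 0 < ε →
      Tendsto (fun n => μ {ω | ε ≤ eLpNorm (φ n ω - φ₀) 2 P₀}) atTop (𝓝 0))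
    -- (A3)
    (hR : IsLittleOPRootN μ (fun n ω =>
      T (η n ω) (empiricalMeasure X n ω) - T η₀ P₀
        - (empiricalMean X n ω (φ n ω) - ∫ x, φ n ω x ∂P₀))) :
    -- asymptotic linearity
    IsLittleOPRootN μ (fun n ω =>
      T (η n ω) (empiricalMeasure X n ω) - (T η₀ P₀ + empiricalMean X n ω φ₀)) ∧
    -- convergence in distribution to `𝔾₀ φ₀`
    WeaklyConverges μ
      (fun n ω => √(n : ℝ) * (T (η n ω) (empiricalMeasure X n ω) - T η₀ P₀))
      (ν.map (fun z : EllInfty F => z ⟨φ₀, hφ₀_mem⟩)) ∧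
    -- `𝔾₀ φ₀` is `N(0, P₀ φ₀²)`
    ν.map (fun z : EllInfty F => z ⟨φ₀, hφ₀_mem⟩) =
      gaussianReal 0 (∫ x, φ₀ x ^ 2 ∂P₀).toNNReal := by
  have := hF.brownianBridge.isProbabilityMeasure
  have hcont := EllInfty.continuous_apply (F := F) ⟨φ₀, hφ₀_mem⟩
  have hlin : ∀ ε : ℝ, 0 < ε → Tendsto (fun n : ℕ => μ {ω | ε ≤ |√(n : ℝ) *
      (T (η n ω) (empiricalMeasure X n ω) - (T η₀ P₀ + empiricalMean X n ω φ₀))|})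
      atTop (𝓝 0) := by
    intro ε hε
    -- The split into `√n R_n` and `𝔾_n φ_n - 𝔾_n φ₀`; the identity uses `P₀ φ₀ = 0`.
    refine (tendsto_measure_le_abs_add (Z := fun n ω => empiricalProcess P₀ X n ω (φ n ω) -
      empiricalProcess P₀ X n ω φ₀) (Y := fun (n : ℕ) ω => √(n : ℝ) *
        (T (η n ω) (empiricalMeasure X n ω) - T η₀ P₀
        - (empiricalMean X n ω (φ n ω) - ∫ x, φ n ω x ∂P₀))) ?_
      (fun ε hε => hF.tendsto_measure_abs_increment hφ₀_mem hφ_mem hφ_cons hε) hε).congr ?_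
    · intro ε hε
      simpa only [abs_mul, abs_of_nonneg (Real.sqrt_nonneg _)] using hR ε hε
    · intro n
      congr! 5 with ω
      simp only [empiricalProcess, hφ₀_mean]
      ring
  have hlaw : ν.map (fun z : EllInfty F => z ⟨φ₀, hφ₀_mem⟩) =
      gaussianReal 0 (∫ x, φ₀ x ^ 2 ∂P₀).toNNReal := by
    rw [(hF.brownianBridge.gaussian.hasGaussianLaw_eval ⟨φ₀, hφ₀_mem⟩).map_eq_gaussianReal,
      hF.brownianBridge.mean_zero, hF.brownianBridge.variance_apply]
    simp [hφ₀_mean]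
  refine ⟨fun ε hε => ?_, ?_, hlaw⟩
  · simpa only [abs_mul, abs_of_nonneg (Real.sqrt_nonneg _)] using hlin ε hε
  · have : IsProbabilityMeasure (ν.map fun z : EllInfty F => z ⟨φ₀, hφ₀_mem⟩) :=
      Measure.isProbabilityMeasure_map hcont.measurable.aemeasurable
    -- Almost surely the mapped path is `𝔾_n φ₀ = √n ℙ_n φ₀`, so its distance to the scaled
    -- estimation error is exactly the quantity controlled by `hlin`.
    refine (hF.weaklyConverges.map hcont).of_tendsto_measure_dist fun δ hδ => ?_
    refine (hlin δ hδ).congr fun n => measure_congr ?_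
    filter_upwards [hF.bounded n] with ω hω
    refine propext ?_
    change _ ≤ _ ↔ _ ≤ _
    rw [toEllInfty_apply hω]
    simp only [empiricalProcess, hφ₀_mean]
    ring_nf
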